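/- Let $k$ be a field, let $R=k[x_1,\ldots,x_d]$, and let $I\subseteq R$ be a monomial ideal (an ideal generated by monomials) with $0\neq I\neq R$. Let $\operatorname{ara}(I)$ denote the arithmetic rank of $I$, that is, the least $u$ for which there exist $g_1,\ldots,g_u\in R$ with $\sqrt{(g_1,\ldots,g_u)}=\sqrt{I}$, and let $\operatorname{bight} I$ denote the big height of $I$, that is, the largest height of a minimal prime of $I$. Then $$\operatorname{ara}(I)\leq d-\left\lfloor\frac{d-1}{\operatorname{bight} I}\right\rfloor .$$ -/

import Mathlib

/-- An ideal of a polynomial ring is a monomial ideal if it is generated by monomials. -/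
def IsMonomialIdeal {k : Type*} [CommSemiring k] {σ : Type*}
    (I : Ideal (MvPolynomial σ k)) : Prop :=
  ∃ S : Set (σ →₀ ℕ), I = Ideal.span ((fun a => MvPolynomial.monomial a (1 : k)) '' S)

/-- The arithmetic rank of an ideal: the least number `u` of elements `g 0, …, g (u - 1)` of the
ring such that the radical of `(g 0, …, g (u - 1))` is the radical of `I`
(and `⊤` if there is no such `u`). -/
noncomputable def arithmeticRank {R : Type*} [CommRing R] (I : Ideal R) : ℕ∞ :=
  ⨅ (u : ℕ) (_ : ∃ g : Fin u → R, (Ideal.span (Set.range g)).radical = I.radical), (u : ℕ∞)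

/-- The big height of an ideal: the largest height of a minimal prime of the ideal. -/
noncomputable def bigHeight {R : Type*} [CommRing R] (I : Ideal R) : ℕ∞ :=
  ⨆ p ∈ I.minimalPrimes, p.height

/-- In a Noetherian ring the big height is finite, so that its value in `ℕ` is the true one. -/
theorem bigHeight_ne_top {R : Type*} [CommRing R] [IsNoetherianRing R] (I : Ideal R) :
    bigHeight I ≠ ⊤ := by
  obtain h | h := I.minimalPrimes.eq_empty_or_nonempty
  · simp [bigHeight, h]
  · rw [← lt_top_iff_ne_top, bigHeight, ← sSup_image,
      ((I.finite_minimalPrimes_of_isNoetherianRing).image _).csSup_lt_iff (h.image _)]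
    rintro _ ⟨p, hp, rfl⟩
    have := hp.isPrime
    exact Ideal.height_lt_top this.ne_top

/-! Minimal primes of a monomial ideal are generated by sets `C` of variables, with `#C ≤ b`, the
big height. One such `C` is removed and the equations are found by induction on the set of
variables. A prime `p` has a trace `T = {v ∈ C | x v ∈ p}`. If `T = C`, it lies in the locus;
otherwise membership depends on the variables outside `C` only, through a tuple `g T` of length `n`
given by induction, whose locus grows with `T`.

`exists_glued_equations` merges these tuples at the cost of `#C - 1` equations. With `y T = ∏ v ∈ C
\ T, x v`, the sum `F = ∑ y T • r T` reads `(y T + L T) r T` modulo a prime of trace `T`, where `r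
T` consists of powers of `g T` and `L T` collects the larger sets. So `F` forces `r T` to vanish
once this matrix has nonzero determinant, and the equations `E` force the determinant to be `y T ^
n`. One `E` serves all `T` of a given size. Each removal of `C` thus raises the count by at most `#C
- 1`, and at least `⌈d / b⌉` removals would be needed to exhaust the variables. -/

/-! ### Gluing equations along the traces on `C` -/

open Finset in
/-- A family of tuples with growing zero loci can be replaced, without changing the loci, by tuples
that are linear combinations of the smaller ones, with coefficients vanishing on the larger loci. -/
theorem exists_compatible_powers {R V : Type*} [CommRing R] [DecidableEq V] (C : Finset V) {n : ℕ}
    (g : Finset V → Fin n → R)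
    (hg : ∀ T ∈ C.ssubsets, ∀ T' ∈ C.ssubsets, T ⊆ T' → ∀ p : Ideal R, p.IsPrime →
      (∀ i, g T i ∈ p) → ∀ i, g T' i ∈ p) :
    ∃ (r : Finset V → Fin n → R) (N : Finset V → Finset V → Matrix (Fin n) (Fin n) R),
      (∀ T, ∀ p : Ideal R, p.IsPrime → ∀ i, r T i ∈ p ↔ g T i ∈ p) ∧
      (∀ T T', ∀ p : Ideal R, p.IsPrime → (∀ i, g T' i ∈ p) → ∀ i j, N T T' i j ∈ p) ∧
      ∀ T ∈ C.ssubsets, ∀ T' ∈ C.ssubsets, T ⊂ T' → r T' = (N T T').mulVec (r T) := by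
  have key : ∀ e : ℕ, ∃ m : ℕ, ∀ m' ≥ m, ∀ T ∈ C.ssubsets, ∀ T' ∈ C.ssubsets, T ⊆ T' → ∀ i,
      g T' i ^ m' ∈ Ideal.span (Set.range fun j => g T j ^ e) := by
    intro e
    rw [← Filter.eventually_atTop]
    rw [Filter.eventually_all_finset]; intro T hT
    rw [Filter.eventually_all_finset]; intro T' hT'
    rw [Filter.eventually_all]; intro hTT'
    rw [Filter.eventually_all]; intro i
    have : g T' i ∈ (Ideal.span (Set.range fun j => g T j ^ e)).radical := by
      rw [Ideal.radical_eq_sInf, Ideal.mem_sInf]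
      rintro p ⟨hp, hpp⟩
      refine hg T hT T' hT' hTT' p hpp (fun j => ?_) i
      exact hpp.mem_of_pow_mem e (hp (Ideal.subset_span ⟨j, rfl⟩))
    obtain ⟨m, hm⟩ := this
    filter_upwards [Filter.eventually_ge_atTop m] with m' hm'
    exact Ideal.mem_of_dvd _ (pow_dvd_pow _ hm') hm
  choose M hM using key
  -- The exponent depends on `#T` only and grows so fast that `e (k + 1) - 1 ≥ M (e k)`.
  let e : ℕ → ℕ := fun k => Nat.rec 1 (fun _ a => M a + a + 1) k
  have he : ∀ k, e (k + 1) = M (e k) + e k + 1 := fun k => rfl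
  have hmono : Monotone e := monotone_nat_of_le_succ fun k => by rw [he]; omega
  have hpos : ∀ k, e k ≠ 0 := fun k => by
    have := hmono (Nat.zero_le k)
    have h0 : e 0 = 1 := rfl
    omega
  have hc : ∀ T T' : Finset V, ∀ i : Fin n, ∃ c : Fin n → R,
      T ∈ C.ssubsets → T' ∈ C.ssubsets → T ⊂ T' →
      ∑ j, c j * g T j ^ e #T = g T' i ^ (e #T' - 1) := by
    intro T T' i
    by_cases h : T ∈ C.ssubsets ∧ T' ∈ C.ssubsets ∧ T ⊂ T'
    · obtain ⟨hT, hT', hTT'⟩ := h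
      have hlt := card_lt_card hTT'
      obtain ⟨k, hk⟩ : ∃ k, #T' = k + 1 := ⟨#T' - 1, by omega⟩
      have hle : e #T ≤ e k := hmono (by omega)
      have h1 := hM (e k) (e #T' - 1) (by rw [hk, he]; omega) T hT T' hT' hTT'.subset i
      have h2 : Ideal.span (Set.range fun j => g T j ^ e k) ≤
          Ideal.span (Set.range fun j => g T j ^ e #T) := by
        rw [Ideal.span_le]
        rintro _ ⟨j, rfl⟩
        exact Ideal.mem_of_dvd _ (pow_dvd_pow _ hle) (Ideal.subset_span ⟨j, rfl⟩)
      obtain ⟨c, hc⟩ := (Ideal.mem_span_range_iff_exists_fun).1 (h2 h1)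
      exact ⟨c, fun _ _ _ => hc⟩
    · exact ⟨0, fun h1 h2 h3 => absurd ⟨h1, h2, h3⟩ h⟩
  choose c hc using hc
  -- The factor `g T' i` held back by the exponent `e #T' - 1` goes into the matrix, which therefore
  -- vanishes on the locus of `g T'`.
  refine ⟨fun T i => g T i ^ e #T, fun T T' => Matrix.of fun i j => g T' i * c T T' i j,
    ?_, ?_, ?_⟩
  · intro T p hp i
    exact hp.pow_mem_iff_mem _ (Nat.pos_of_ne_zero (hpos _))
  · intro T T' p _ h i j
    exact p.mul_mem_right _ (h i)
  · intro T hT T' hT' hTT'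
    ext i
    simp only [Matrix.mulVec, dotProduct, Matrix.of_apply, mul_assoc, ← Finset.mul_sum]
    rw [hc T T' i hT hT' hTT', ← pow_succ']
    congr 1
    have := hpos #T'
    omega

/-- If a square matrix is congruent to a scalar matrix modulo an ideal, then so is its
determinant. -/
theorem det_sub_pow_mem {R : Type*} [CommRing R] {n : ℕ} (p : Ideal R) (a : R)
    (N : Matrix (Fin n) (Fin n) R) (hN : ∀ i j, N i j ∈ p) :
    (Matrix.scalar (Fin n) a + N).det - a ^ n ∈ p := by
  rw [← Ideal.Quotient.eq, RingHom.map_det, map_pow]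
  have : (Ideal.Quotient.mk p).mapMatrix (Matrix.scalar (Fin n) a + N) =
      Matrix.scalar (Fin n) (Ideal.Quotient.mk p a) := by
    ext i j
    have h := Ideal.Quotient.eq_zero_iff_mem.2 (hN i j)
    by_cases hij : i = j
    · subst hij; simp [h]
    · simp [h, hij, Matrix.diagonal_apply_ne]
  rw [this]
  simp

/-- If a matrix with determinant outside a prime sends a vector into the prime, then the vector
lies in the prime. -/
theorem mem_of_mulVec_mem {R : Type*} [CommRing R] {n : ℕ} (p : Ideal R) [p.IsPrime]
    (M : Matrix (Fin n) (Fin n) R) (v : Fin n → R) (hM : M.det ∉ p)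
    (h : ∀ i, M.mulVec v i ∈ p) (i : Fin n) : v i ∈ p := by
  have h1 : M.det * v i = ∑ j, M.adjugate i j * M.mulVec v j := by
    have : (M.adjugate.mulVec (M.mulVec v)) i = M.det * v i := by
      rw [Matrix.mulVec_mulVec, Matrix.adjugate_mul, Matrix.smul_mulVec, Matrix.one_mulVec]
      rfl
    rw [← this]; rfl
  have h2 : M.det * v i ∈ p := by
    rw [h1]
    exact Ideal.sum_mem _ fun j _ => p.mul_mem_left _ (h j)
  exact (Ideal.IsPrime.mem_or_mem ‹_› h2).resolve_left hM

open Finset in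
/-- The gluing step: if the loci of the tuples `g T` grow with the proper subset `T` of `C`, then
`n + (#C - 1)` equations cut out the primes `p` that contain all `x v`, `v ∈ C`, or contain the
tuple `g T` for `T = {v ∈ C | x v ∈ p}`. -/
theorem exists_glued_equations {R V : Type*} [CommRing R] [DecidableEq V] (x : V → R)
    (C : Finset V) {n : ℕ} (g : Finset V → Fin n → R)
    (hg : ∀ T ∈ C.ssubsets, ∀ T' ∈ C.ssubsets, T ⊆ T' → ∀ p : Ideal R, p.IsPrime →
      (∀ i, g T i ∈ p) → ∀ i, g T' i ∈ p) :
    ∃ f : Fin n ⊕ Fin (#C - 1) → R, ∀ p : Ideal R, p.IsPrime → ∀ T ⊆ C,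
      (∀ v ∈ C, x v ∈ p ↔ v ∈ T) → ((∀ i, f i ∈ p) ↔ (T = C ∨ ∀ i, g T i ∈ p)) := by
  obtain ⟨r, N, hr, hN, hrN⟩ := exists_compatible_powers C g hg
  let y : Finset V → R := fun T => ∏ v ∈ C \ T, x v
  let L : Finset V → Matrix (Fin n) (Fin n) R := fun T =>
    ∑ T' ∈ C.ssubsets with T ⊂ T', y T' • N T T'
  let F : Fin n → R := fun i => ∑ T ∈ C.ssubsets, y T * r T i
  let E : ℕ → R := fun k => ∑ T ∈ C.ssubsets with #T = k,
    y T * ((Matrix.scalar (Fin n) (y T) + L T).det - y T ^ n)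
  refine ⟨Sum.elim F fun k => E k, fun p hp T hT hTp => ?_⟩
  -- Modulo `p` only the terms with `T ⊆ T'` survive; among sets of size `#T`, only `T` itself.
  have hy : ∀ T' ⊆ C, y T' ∈ p ↔ ¬ T ⊆ T' := by
    intro T' _
    rw [hp.prod_mem_iff, Finset.not_subset]
    constructor
    · rintro ⟨v, hv, hvp⟩
      rw [mem_sdiff] at hv
      exact ⟨v, (hTp v hv.1).1 hvp, hv.2⟩
    · rintro ⟨v, hv, hv'⟩
      exact ⟨v, mem_sdiff.2 ⟨hT hv, hv'⟩, (hTp v (hT hv)).2 hv⟩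
  constructor
  · intro h
    by_contra! hcon
    obtain ⟨hTC, i, hi⟩ := hcon
    have hTs : T ∈ C.ssubsets := mem_ssubsets.2 (hT.ssubset_of_ne hTC)
    have hyT : y T ∉ p := by rw [hy T hT]; simp
    have hlt : #T < #C := card_lt_card (mem_ssubsets.1 hTs)
    have hFM : ∀ i, F i - ((Matrix.scalar (Fin n) (y T) + L T).mulVec (r T)) i ∈ p := by
      intro i
      have h1 : ((Matrix.scalar (Fin n) (y T) + L T).mulVec (r T)) i =
          y T * r T i + ∑ T' ∈ C.ssubsets with T ⊂ T', y T' * r T' i := by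
        rw [Matrix.add_mulVec, Matrix.sum_mulVec]
        simp only [Pi.add_apply, Finset.sum_apply, Matrix.scalar_apply, Matrix.mulVec_diagonal]
        congr 1
        refine sum_congr rfl fun T' hT' => ?_
        rw [mem_filter] at hT'
        rw [Matrix.smul_mulVec, hrN T hTs T' hT'.1 hT'.2]
        rfl
      have h2 : F i = ∑ T' ∈ C.ssubsets with T ⊆ T', y T' * r T' i +
          ∑ T' ∈ C.ssubsets with ¬ T ⊆ T', y T' * r T' i :=
        (sum_filter_add_sum_filter_not _ _ _).symm
      have h3 : C.ssubsets.filter (T ⊆ ·) = insert T (C.ssubsets.filter (T ⊂ ·)) := by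
        ext T'
        simp only [mem_filter, mem_insert]
        constructor
        · rintro ⟨h1, h2⟩
          rcases h2.eq_or_ssubset with h | h
          · exact Or.inl h.symm
          · exact Or.inr ⟨h1, h⟩
        · rintro (rfl | ⟨h1, h2⟩)
          · exact ⟨hTs, Subset.rfl⟩
          · exact ⟨h1, h2.subset⟩
      rw [h1, h2, h3, sum_insert (by simp), add_sub_cancel_left]
      refine Ideal.sum_mem _ fun T' hT' => p.mul_mem_right _ ?_
      rw [mem_filter] at hT'
      exact (hy T' (mem_ssubsets.1 hT'.1).subset).2 hT'.2
    have hM0 : ∀ i, ((Matrix.scalar (Fin n) (y T) + L T).mulVec (r T)) i ∈ p := fun i => by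
      simpa using p.sub_mem (h (Sum.inl i)) (hFM i)
    refine hi ((hr T p hp i).1 (mem_of_mulVec_mem p _ (r T) ?_ hM0 i))
    -- Sizes `0, …, #C - 2` have an equation `E`. For size `#C - 1` no larger proper subset exists,
    -- so `L T = 0` and none is needed.
    by_cases hk : #T < #C - 1
    · have hE : E #T ∈ p := h (Sum.inr ⟨#T, hk⟩)
      have hTf : T ∈ C.ssubsets.filter (fun T' => #T' = #T) := mem_filter.2 ⟨hTs, rfl⟩
      have hE' : E #T = _ := (add_sum_erase _ _ hTf).symm
      rw [hE', Ideal.add_mem_iff_left] at hE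
      · have h4 := (hp.mem_or_mem hE).resolve_left hyT
        intro hdet
        exact hyT (hp.mem_of_pow_mem n (by simpa using p.sub_mem hdet h4))
      · refine Ideal.sum_mem _ fun T' hT' => p.mul_mem_right _ ?_
        rw [mem_erase, mem_filter] at hT'
        refine (hy T' (mem_ssubsets.1 hT'.2.1).subset).2 fun hsub => hT'.1 ?_
        exact (eq_of_subset_of_card_le hsub hT'.2.2.le).symm
    · have hL : L T = 0 := by
        refine sum_eq_zero fun T' hT' => ?_
        rw [mem_filter, mem_ssubsets] at hT'
        have := card_lt_card hT'.1
        have := card_lt_card hT'.2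
        omega
      rw [hL, add_zero]
      simpa using fun h => hyT (hp.mem_of_pow_mem n h)
  · intro h
    have hterm : ∀ T' ∈ C.ssubsets, y T' ∈ p ∨ (T ⊆ T' ∧ T ∈ C.ssubsets ∧ ∀ i, g T i ∈ p) := by
      intro T' hT'
      rw [hy T' (mem_ssubsets.1 hT').subset]
      by_cases hsub : T ⊆ T'
      · refine Or.inr ⟨hsub, mem_ssubsets.2 (hsub.trans_ssubset (mem_ssubsets.1 hT')), ?_⟩
        rcases h with rfl | h
        · exact absurd hsub (mem_ssubsets.1 hT').not_subset
        · exact h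
      · exact Or.inl hsub
    rintro (i | k)
    · refine Ideal.sum_mem _ fun T' hT' => ?_
      rcases hterm T' hT' with h1 | ⟨h1, h2, h3⟩
      · exact p.mul_mem_right _ h1
      · exact p.mul_mem_left _ ((hr T' p hp i).2 (hg T h2 T' hT' h1 p hp h3 i))
    · refine Ideal.sum_mem _ fun T' hT' => ?_
      rw [mem_filter] at hT'
      rcases hterm T' hT'.1 with h1 | ⟨h1, h2, h3⟩
      · exact p.mul_mem_right _ h1
      · refine p.mul_mem_left _ (det_sub_pow_mem p _ _ fun i j => ?_)
        simp only [L, Matrix.sum_apply, Matrix.smul_apply, smul_eq_mul]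
        refine Ideal.sum_mem _ fun T'' hT'' => p.mul_mem_left _ ?_
        rw [mem_filter] at hT''
        exact hN _ _ p hp (hg T h2 T'' hT''.1 (h1.trans hT''.2.subset) p hp h3) i j

/-! ### Induction on the set of variables -/

/-- Let `H` be a family of subsets of a finite set `U`, each of size at most `b`. The primes that
contain the elements `x v`, `v ∈ C`, for some `C ∈ H` are cut out by `#U + 1 - ⌈#U / b⌉`
equations. -/
theorem exists_equations_of_card_le {R V : Type*} [CommRing R] [DecidableEq V] (x : V → R)
    {b : ℕ} (hb : 0 < b) (U : Finset V) (H : Set (Finset V))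
    (hH : ∀ C ∈ H, C ⊆ U ∧ C.card ≤ b) :
    ∃ f : Fin (U.card + 1 - (U.card + b - 1) / b) → R, ∀ p : Ideal R, p.IsPrime →
      ((∀ i, f i ∈ p) ↔ ∃ C ∈ H, ∀ v ∈ C, x v ∈ p) := by
  classical
  induction U using Finset.strongInduction generalizing H with
  | H U ih =>
  rcases H.eq_empty_or_nonempty with rfl | ⟨C, hC⟩
  -- The empty locus needs a unit among the equations, so their number must be positive.
  · refine ⟨fun _ => 1, fun p hp => ?_⟩
    have hpos : (U.card + b - 1) / b < U.card + 1 := by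
      rw [Nat.div_lt_iff_lt_mul hb]
      have : U.card ≤ U.card * b := Nat.le_mul_of_pos_right _ hb
      rw [add_mul]; omega
    have h1 : ¬ ∀ i : Fin (U.card + 1 - (U.card + b - 1) / b), (1 : R) ∈ p := fun h =>
      hp.ne_top ((Ideal.eq_top_iff_one p).2 (h ⟨0, by omega⟩))
    simp [h1]
  · obtain ⟨hCU, hCb⟩ := hH C hC
    rcases C.eq_empty_or_nonempty with rfl | hne
    · exact ⟨0, fun p _ => ⟨fun _ => ⟨∅, hC, by simp⟩, fun _ i => p.zero_mem⟩⟩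
    -- What remains to be imposed outside `C` at trace `T`: only those `C'` count whose part in `C`
    -- already vanishes.
    · let HT : Finset V → Set (Finset V) := fun T => {D | ∃ C' ∈ H, C' ∩ C ⊆ T ∧ D = C' \ C}
      have hss : U \ C ⊂ U := Finset.sdiff_ssubset hCU hne
      have hHT : ∀ T, ∀ D ∈ HT T, D ⊆ U \ C ∧ D.card ≤ b := by
        rintro T _ ⟨C', hC', -, rfl⟩
        exact ⟨Finset.sdiff_subset_sdiff (hH C' hC').1 Finset.Subset.rfl,
          (Finset.card_le_card Finset.sdiff_subset).trans (hH C' hC').2⟩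
      choose g hg using fun T => ih (U \ C) hss (HT T) (hHT T)
      obtain ⟨f, hf⟩ := exists_glued_equations x C g (by
        intro T _ T' _ hTT' p hp h
        rw [hg T p hp] at h
        rw [hg T' p hp]
        obtain ⟨_, ⟨C', hC', h1, rfl⟩, h2⟩ := h
        exact ⟨_, ⟨C', hC', h1.trans hTT', rfl⟩, h2⟩)
      have hfloc : ∀ p : Ideal R, p.IsPrime →
          ((∀ i, f i ∈ p) ↔ ∃ C ∈ H, ∀ v ∈ C, x v ∈ p) := by
        intro p hp
        rw [hf p hp (C.filter (x · ∈ p)) (Finset.filter_subset _ _)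
          (fun v hv => by simp [hv]), hg _ p hp]
        constructor
        · rintro (h | ⟨_, ⟨C', hC', h1, rfl⟩, h2⟩)
          · exact ⟨C, hC, fun v hv => (Finset.filter_eq_self.1 h) v hv⟩
          · refine ⟨C', hC', fun v hv => ?_⟩
            by_cases hvC : v ∈ C
            · exact (Finset.mem_filter.1 (h1 (Finset.mem_inter.2 ⟨hv, hvC⟩))).2
            · exact h2 v (Finset.mem_sdiff.2 ⟨hv, hvC⟩)
        · rintro ⟨C', hC', h⟩
          refine Or.inr ⟨_, ⟨C', hC', fun v hv => ?_, rfl⟩, fun v hv => ?_⟩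
          · rw [Finset.mem_inter] at hv
            exact Finset.mem_filter.2 ⟨hv.2, h v hv.1⟩
          · exact h v (Finset.mem_sdiff.1 hv).1
      have hcard : Fintype.card (Fin ((U \ C).card + 1 - ((U \ C).card + b - 1) / b) ⊕
          Fin (C.card - 1)) ≤ Fintype.card (Fin (U.card + 1 - (U.card + b - 1) / b)) := by
        rw [Fintype.card_sum, Fintype.card_fin, Fintype.card_fin, Fintype.card_fin]
        have h1 : (U \ C).card + C.card = U.card := Finset.card_sdiff_add_card_eq_card hCU
        have h2 : 0 < C.card := hne.card_pos
        -- Since `#C ≤ b`, removing `C` lowers `⌈#U / b⌉` by at most one.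
        have h3 : (U.card + b - 1) / b ≤ ((U \ C).card + b - 1) / b + 1 := by
          rw [← Nat.add_div_right _ hb]
          exact Nat.div_le_div_right (by omega)
        have h4 : ((U \ C).card + b - 1) / b ≤ (U \ C).card := by
          rw [← Nat.lt_succ_iff, Nat.div_lt_iff_lt_mul hb, Nat.succ_mul]
          have : (U \ C).card ≤ (U \ C).card * b := Nat.le_mul_of_pos_right _ hb
          omega
        omega
      obtain ⟨e⟩ := Function.Embedding.nonempty_of_card_le hcard
      -- Surplus positions are padded with zeros.
      refine ⟨Function.extend e f 0, fun p hp => ?_⟩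
      rw [← hfloc p hp]
      constructor
      · intro h i
        rw [← e.injective.extend_apply f 0 i]
        exact h (e i)
      · intro h j
        by_cases hj : ∃ i, e i = j
        · obtain ⟨i, rfl⟩ := hj
          rw [e.injective.extend_apply]
          exact h i
        · rw [Function.extend_apply' _ _ _ hj]
          exact p.zero_mem

/-! ### Primes generated by variables -/

namespace MvPolynomial

variable {k σ : Type*} [Field k]

/-- The prime ideal generated by the variables in `s`, as the kernel of the substitution that sends
these variables to zero. -/
noncomputable def variableIdeal (k : Type*) [Field k] {σ : Type*} (s : Set σ) :
    Ideal (MvPolynomial σ k) :=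
  open Classical in
  RingHom.ker (aeval fun v => if v ∈ s then (0 : MvPolynomial σ k) else X v :
    MvPolynomial σ k →ₐ[k] MvPolynomial σ k)

instance (s : Set σ) : (variableIdeal k s).IsPrime := by
  classical exact RingHom.ker_isPrime _

theorem X_mem_variableIdeal {s : Set σ} {v : σ} : X v ∈ variableIdeal k s ↔ v ∈ s := by
  classical
  rw [variableIdeal, RingHom.mem_ker, aeval_X]
  split_ifs with h <;> simp [h]

theorem variableIdeal_le {s : Set σ} {J : Ideal (MvPolynomial σ k)} (h : ∀ v ∈ s, X v ∈ J) :
    variableIdeal k s ≤ J := by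
  classical
  intro f hf
  -- Modulo `J` the substitution is the identity, as can be checked on the variables.
  have key : ∀ f : MvPolynomial σ k, f - aeval (fun v => if v ∈ s then (0 : MvPolynomial σ k)
      else X v) f ∈ J := by
    intro f
    rw [← Ideal.Quotient.eq]
    have : (Ideal.Quotient.mkₐ k J) = (Ideal.Quotient.mkₐ k J).comp
        (aeval fun v => if v ∈ s then (0 : MvPolynomial σ k) else X v) := by
      ext v
      simp only [AlgHom.comp_apply, aeval_X]
      split_ifs with hv
      · simpa using Ideal.Quotient.eq_zero_iff_mem.2 (h v hv)
      · rfl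
    exact DFunLike.congr_fun this f
  have h0 := key f
  rw [variableIdeal, RingHom.mem_ker] at hf
  have hf' : aeval (fun v => if v ∈ s then (0 : MvPolynomial σ k) else X v) f = 0 := hf
  rwa [hf', sub_zero] at h0

/-- Adjoining the variables one at a time gives a strict chain of primes. This bounds the size of
each `C` by the big height. -/
theorem card_le_height_variableIdeal (s : Finset σ) :
    (s.card : ℕ∞) ≤ (variableIdeal k (s : Set σ)).height := by
  classical
  induction s using Finset.induction_on with
  | empty => simp
  | insert a s ha ih =>
    have hlt : variableIdeal k (s : Set σ) < variableIdeal k ((insert a s : Finset σ) : Set σ) := by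
      refine lt_of_le_of_ne (variableIdeal_le fun v hv => X_mem_variableIdeal.2 ?_) fun h => ?_
      · exact Finset.mem_insert_of_mem hv
      · have : X a ∈ variableIdeal k (s : Set σ) := by
          rw [h]
          exact X_mem_variableIdeal.2 (by simp)
        exact ha (X_mem_variableIdeal.1 this)
    rw [Finset.card_insert_of_notMem ha]
    rw [Nat.cast_add, Nat.cast_one]
    exact (add_le_add_left ih 1).trans (Ideal.height_add_one_le_of_lt_of_isPrime hlt)

/-- A prime containing a monomial ideal contains a prime generated by variables that contains the
monomial ideal. -/
theorem le_variableIdeal_of_isMonomialIdeal {I p : Ideal (MvPolynomial σ k)} [p.IsPrime]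
    (hI : IsMonomialIdeal I) (hp : I ≤ p) : I ≤ variableIdeal k {v | X v ∈ p} := by
  obtain ⟨S, rfl⟩ := hI
  rw [Ideal.span_le]
  rintro _ ⟨a, ha, rfl⟩
  have h : monomial a (1 : k) ∈ p := hp (Ideal.subset_span ⟨a, ha, rfl⟩)
  rw [monomial_eq, C_1, one_mul, Finsupp.prod, Ideal.IsPrime.prod_mem_iff] at h
  obtain ⟨v, hv, hvp⟩ := h
  change monomial a (1 : k) ∈ variableIdeal k {v | X v ∈ p}
  rw [monomial_eq, C_1, one_mul, Finsupp.prod, Ideal.IsPrime.prod_mem_iff]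
  refine ⟨v, hv, Ideal.pow_mem_of_mem _ ?_ _ (Nat.pos_of_ne_zero (Finsupp.mem_support_iff.1 hv))⟩
  exact X_mem_variableIdeal.2 (Ideal.IsPrime.mem_of_pow_mem ‹_› _ hvp)

/-- The variables in `p` generate a prime between `I` and `p`, so minimality forces equality. -/
theorem eq_variableIdeal_of_mem_minimalPrimes {I p : Ideal (MvPolynomial σ k)}
    (hI : IsMonomialIdeal I) (hp : p ∈ I.minimalPrimes) :
    p = variableIdeal k {v | X v ∈ p} := by
  have := hp.isPrime
  have hle : variableIdeal k {v | X v ∈ p} ≤ p := variableIdeal_le fun v hv => hv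
  exact le_antisymm
    (hp.2 ⟨inferInstance, le_variableIdeal_of_isMonomialIdeal hI hp.1.2⟩ hle) hle

end MvPolynomial

/-! ### The bound on the arithmetic rank -/

open MvPolynomial in
theorem corollary4p2 {k : Type*} [Field k] (d : ℕ) (I : Ideal (MvPolynomial (Fin d) k))
    (hI : IsMonomialIdeal I) (hI0 : I ≠ ⊥) (hI1 : I ≠ ⊤) :
    arithmeticRank I ≤ ((d - (d - 1) / (bigHeight I).toNat : ℕ) : ℕ∞) := by
  classical
  set b := (bigHeight I).toNat with hbdef
  let H : Set (Finset (Fin d)) :=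
    {C | ∃ p ∈ I.minimalPrimes, C = Finset.univ.filter fun v => X v ∈ p}
  have hcoe : ∀ p : Ideal (MvPolynomial (Fin d) k),
      ((Finset.univ.filter fun v => X v ∈ p : Finset (Fin d)) : Set (Fin d)) = {v | X v ∈ p} := by
    intro p; ext; simp
  have hHb : ∀ C ∈ H, C ⊆ Finset.univ ∧ C.card ≤ b := by
    rintro _ ⟨p, hp, rfl⟩
    refine ⟨Finset.subset_univ _, ?_⟩
    have h1 := card_le_height_variableIdeal (k := k) (Finset.univ.filter fun v => X v ∈ p)
    rw [hcoe, ← eq_variableIdeal_of_mem_minimalPrimes hI hp] at h1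
    have h2 : p.height ≤ bigHeight I := le_iSup₂_of_le p hp le_rfl
    rw [← ENat.natCast_le_natCast, hbdef, ENat.natCast_toNat (bigHeight_ne_top I)]
    exact h1.trans h2
  obtain ⟨p₀, hp₀⟩ := I.nonempty_minimalPrimes hI1
  have hne : (Finset.univ.filter fun v => X v ∈ p₀ : Finset (Fin d)).Nonempty := by
    by_contra hempty
    have h0 : p₀ = ⊥ := by
      rw [eq_bot_iff, eq_variableIdeal_of_mem_minimalPrimes hI hp₀]
      refine variableIdeal_le fun v hv => (hempty ⟨v, ?_⟩).elim
      simpa using hv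
    exact hI0 (le_bot_iff.1 (h0 ▸ hp₀.1.2))
  have hb : 0 < b := hne.card_pos.trans_le (hHb _ ⟨p₀, hp₀, rfl⟩).2
  have hd : 0 < d := by
    obtain ⟨v, -⟩ := hne
    exact v.pos
  obtain ⟨f, hf⟩ := exists_equations_of_card_le (X : Fin d → MvPolynomial (Fin d) k) hb
    Finset.univ H hHb
  have hfI : ∀ p : Ideal (MvPolynomial (Fin d) k), p.IsPrime → ((∀ i, f i ∈ p) ↔ I ≤ p) := by
    intro p hp
    rw [hf p hp]
    constructor
    · rintro ⟨_, ⟨q, hq, rfl⟩, h⟩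
      refine hq.1.2.trans ?_
      rw [eq_variableIdeal_of_mem_minimalPrimes hI hq]
      exact variableIdeal_le fun v hv => h v (by simpa using hv)
    · intro h
      obtain ⟨q, hq, hqp⟩ := Ideal.exists_minimalPrimes_le h
      exact ⟨_, ⟨q, hq, rfl⟩, fun v hv => hqp (by simpa using hv)⟩
  have hrad : (Ideal.span (Set.range f)).radical = I.radical := by
    rw [Ideal.radical_eq_sInf, Ideal.radical_eq_sInf]
    congr 1
    ext p
    simp only [Set.mem_ofPred_eq]
    refine and_congr_left fun hp => ?_
    rw [← hfI p hp, Ideal.span_le, Set.range_subset_iff]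
    rfl
  refine (iInf₂_le _ ⟨f, hrad⟩).trans ?_
  rw [ENat.natCast_le_natCast, Finset.card_univ, Fintype.card_fin]
  -- As `d > 0`, `⌈d / b⌉ = ⌊(d - 1) / b⌋ + 1`, which cancels the `+ 1` in the number of equations.
  have : (d + b - 1) / b = (d - 1) / b + 1 := by
    rw [← Nat.add_div_right _ hb]
    congr 1
    omega
  omega
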